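/- \textbf{Theorem.} Let $E$ be an Archimedean vector lattice over $\mathbb{R}$, and let $\tau$ be an o-Lebesgue topology on $E$, i.e. a Hausdorff linear topology such that zero has a neighbourhood basis of solid sets, and such that every net in $E$ that is order convergent to some $x\in E$ is $\tau$-convergent to $x$. Then the following are equivalent: \begin{enumerate} \item $C_\tau=E$; \item $E$ has the countable sup property: every subset of $E$ that has a supremum in $E$ contains an at most countable subset with the same supremum; \item every $\tau$-convergent net in $E$ has an embedded sequence that is uo-convergent to the same limit; \item every increasing $\tau$-convergent net in $E^+$ has an embedded sequence that is uo-convergent to the same limit. \end{enumerate} Here the following definitions are used. Nets are indexed by non-empty directed (pre-ordered) sets. A net $(x_\alpha)_{\alpha\in A}$ is \emph{order convergent} to $x$ if there is a net $(y_\beta)_{\beta\in B}$ in $E$ with $y_\beta\downarrow 0$ such that for every $\beta_0\in B$ there is an $\alpha_0\in A$ with $|x_\alpha-x|\le y_{\beta_0}$ for all $\alpha\ge\alpha_0$; it is \emph{uo-convergent} to $x$ if the net $(|x_\alpha-x|\wedge|y|)_{\alpha\in A}$ is order convergent to $0$ for every $y\in E$. An \emph{embedded sequence} of the net $(x_\alpha)_{\alpha\in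 A}$ is a sequence $(x_{\alpha_n})_{n\ge 1}$ with $\alpha_1\le\alpha_2\le\cdots$ in $A$, and with $\alpha_1<\alpha_2<\cdots$ if $A$ has no largest element. The \emph{carrier} $C_\tau$ is the union of the disjoint complements $N^{\mathrm d}=\{x\in E: |x|\wedge|y|=0 \text{ for all } y\in N\}$, where $N$ runs over all sets $N=\bigcap_{n\ge1}V_n$ with $(V_n)_{n\ge 1}$ a sequence of solid $\tau$-neighbourhoods of zero such that $V_{n+1}+V_{n+1}\subseteq V_n$ for all $n$. -/

import Mathlib

open Set Filter Topology

universe u v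

section Order

variable {E : Type u} [AddCommGroup E] [Lattice E]

/-- A vector lattice is Archimedean if the only positive `x` all of whose multiples `n • x`
are bounded by one and the same element is `0`. (The class `Archimedean` of Mathlib is a
different notion for partially ordered groups: it fails for `ℝ × ℝ`.) -/
def IsArchimedeanLattice (E : Type u) [AddCommGroup E] [Lattice E] : Prop :=
  ∀ x y : E, 0 ≤ x → (∀ n : ℕ, n • x ≤ y) → x = 0

/-- Order convergence of a net `x` to `a`: there is a net `y` decreasing to `0` such that each
member of `y` eventually dominates `|x α - a|`. The index sets of `y` are taken from the universe
of `E`; larger ones give nothing new, since the set of eventual upper bounds of `|x α - a|` can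
itself serve as index set. -/
def OrderConverges {A : Type v} [Preorder A] (x : A → E) (a : E) : Prop :=
  ∃ (B : Type u) (_ : Preorder B) (_ : Nonempty B) (_ : IsDirectedOrder B) (y : B → E),
    Antitone y ∧ IsGLB (range y) 0 ∧
      ∀ β₀ : B, ∃ α₀ : A, ∀ α : A, α₀ ≤ α → |x α - a| ≤ y β₀

/-- Unbounded order convergence of a net `x` to `a`. -/
def UOConverges {A : Type v} [Preorder A] (x : A → E) (a : E) : Prop :=
  ∀ y : E, OrderConverges (fun α => |x α - a| ⊓ |y|) 0

/-- The disjoint complement of a subset of a vector lattice. -/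
def disjointCompl (N : Set E) : Set E :=
  {x | ∀ y ∈ N, |x| ⊓ |y| = 0}

/-- The countable sup property: every subset that has a supremum contains an at most countable
subset with the same supremum. -/
def CountableSupProperty (E : Type u) [Lattice E] : Prop :=
  ∀ (S : Set E) (x : E), IsLUB S x → ∃ C : Set E, C ⊆ S ∧ C.Countable ∧ IsLUB C x

end Order

/-- The indices `i 0, i 1, …` define an embedded sequence of a net indexed by `A`: they are
increasing, and strictly increasing when `A` has no largest element. -/
def IsEmbeddedIndex {A : Type v} [Preorder A] (i : ℕ → A) : Prop :=
  Monotone i ∧ ((¬ ∃ a : A, IsTop a) → StrictMono i)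

section Topology

variable (E : Type u) [AddCommGroup E] [Lattice E] [TopologicalSpace E]

/-- Zero has a neighbourhood basis consisting of solid sets. Together with the requirement
that the topology is a Hausdorff vector space topology this is a locally solid topology. -/
def HasSolidBasis : Prop :=
  (𝓝 (0 : E)).HasBasis
    (fun U : Set E => U ∈ 𝓝 (0 : E) ∧ LatticeOrderedAddCommGroup.IsSolid U) id

/-- Every order convergent net converges topologically to the same limit. -/
def OrderConvergentNetsConverge : Prop :=
  ∀ (A : Type u) [Preorder A] [Nonempty A] [IsDirectedOrder A] (x : A → E) (a : E),
    OrderConverges x a → Tendsto x atTop (𝓝 a)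

/-- An o-Lebesgue topology on a vector lattice: a locally solid (Hausdorff, linear) topology
for which order convergent nets converge topologically to the same limit. -/
structure IsOLebesgue [Module ℝ E] : Prop where
  topologicalAddGroup : IsTopologicalAddGroup E
  continuousSMul : ContinuousSMul ℝ E
  t2Space : T2Space E
  hasSolidBasis : HasSolidBasis E
  tendsto_of_orderConverges : OrderConvergentNetsConverge E

variable {E}

/-- A normal sequence of solid neighbourhoods of zero. -/
def IsNormalSolidSeq (V : ℕ → Set E) : Prop :=
  (∀ n, V n ∈ 𝓝 (0 : E)) ∧ (∀ n, LatticeOrderedAddCommGroup.IsSolid (V n)) ∧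
    ∀ n, ∀ x ∈ V (n + 1), ∀ y ∈ V (n + 1), x + y ∈ V n

variable (E)

/-- The carrier of the topology of `E`: the union of the disjoint complements of all
intersections of normal sequences of solid neighbourhoods of zero. -/
def topCarrier : Set E :=
  {x | ∃ V : ℕ → Set E, IsNormalSolidSeq V ∧ x ∈ disjointCompl (⋂ n, V n)}

end Topology

/-! ### Vector lattice preliminaries: Archimedean arguments, disjointness, order limits -/

section LatticeGroup

variable {E : Type u} [AddCommGroup E] [Lattice E]

/-! The cycle is 1 → 3 → 4 → 2 → 1. Call the intersection of a normal sequence its null set. For 1 →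
3, indices are chosen so that each error `g n` is small for normal sequences whose null sets are
disjoint from the earlier errors. A positive `w` below all eventual bounds of `g n ⊓ b` then lies in
all these null sets, so it is disjoint from every `g k` and must vanish (`orderConverges_inf`). For
4 → 2, finite suprema form an increasing net, and the finite sets along an embedded sequence have a
countable union. For 2 → 1, `exists_mem_topCarrier` makes `|x|` a supremum of carrier elements.
Countably many of them suffice, and their normal sequences have a common refinement. Dedekind
completeness is avoided because upper bounds minus elements have infimum `0`, so the Lebesgue
property still applies. -/

theorem inf_eq_zero_of_le {a b c d : E} (h : a ⊓ b = 0) (hc : 0 ≤ c) (hd : 0 ≤ d)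
    (hca : c ≤ a) (hdb : d ≤ b) : c ⊓ d = 0 :=
  le_antisymm (h ▸ inf_le_inf hca hdb) (le_inf hc hd)

theorem disjointCompl_anti {M N : Set E} (h : M ⊆ N) : disjointCompl N ⊆ disjointCompl M :=
  fun _ hx y hy => hx y (h hy)

variable [IsOrderedAddMonoid E]

/-- Iterating the translation bounds every `n • z` by `u - t`. -/
theorem IsArchimedeanLattice.eq_zero_of_add_mem (hE : IsArchimedeanLattice E) {T : Set E}
    {z t u : E} (hz : 0 ≤ z) (ht : t ∈ T) (hu : u ∈ upperBounds T)
    (hT : ∀ s ∈ T, s + z ∈ T) : z = 0 := by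
  have h : ∀ n : ℕ, t + n • z ∈ T := by
    intro n
    induction n with
    | zero => simpa using ht
    | succ n ih =>
      rw [succ_nsmul, ← add_assoc]
      exact hT _ ih
  exact hE z (u - t) hz fun n => by
    rw [le_sub_iff_add_le']
    exact hu (h n)

theorem IsArchimedeanLattice.eq_zero_of_sub_mem (hE : IsArchimedeanLattice E) {T : Set E}
    {z t l : E} (hz : 0 ≤ z) (ht : t ∈ T) (hl : l ∈ lowerBounds T)
    (hT : ∀ s ∈ T, s - z ∈ T) : z = 0 := by
  refine hE.eq_zero_of_add_mem (T := -T) (t := -t) (u := -l) hz (by simpa using ht) ?_ ?_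
  · intro s hs
    exact le_neg_of_le_neg (hl hs)
  · intro s hs
    have := hT _ hs
    rwa [Set.mem_neg, neg_add, ← sub_eq_add_neg]

theorem add_le_of_inf_eq_zero {p q u : E} (h : p ⊓ q = 0) (hp : p ≤ u) (hq : q ≤ u) :
    p + q ≤ u := by
  rw [← inf_add_sup, h, zero_add]
  exact sup_le hp hq

theorem add_inf_le_inf_add_inf {a b c : E} (ha : 0 ≤ a) (hb : 0 ≤ b) (hc : 0 ≤ c) :
    (a + b) ⊓ c ≤ a ⊓ c + b ⊓ c := by
  rw [add_inf, inf_add, inf_add]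
  refine le_inf (le_inf inf_le_left ?_) (le_inf ?_ ?_)
  · exact inf_le_right.trans (le_add_of_nonneg_right hb)
  · exact inf_le_right.trans (le_add_of_nonneg_left ha)
  · exact inf_le_right.trans (le_add_of_nonneg_left hc)

theorem mem_disjointCompl_of_abs_le {N : Set E} {x y : E} (hx : x ∈ disjointCompl N)
    (h : |y| ≤ |x|) : y ∈ disjointCompl N := fun n hn =>
  inf_eq_zero_of_le (hx n hn) (abs_nonneg _) (abs_nonneg _) h le_rfl

theorem add_mem_disjointCompl {N : Set E} {x y : E} (hx : x ∈ disjointCompl N)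
    (hy : y ∈ disjointCompl N) : x + y ∈ disjointCompl N := by
  intro n hn
  refine le_antisymm ?_ (le_inf (abs_nonneg _) (abs_nonneg _))
  calc |x + y| ⊓ |n| ≤ (|x| + |y|) ⊓ |n| := inf_le_inf_right _ (abs_add_le x y)
    _ ≤ |x| ⊓ |n| + |y| ⊓ |n| :=
      add_inf_le_inf_add_inf (abs_nonneg _) (abs_nonneg _) (abs_nonneg _)
    _ = 0 := by rw [hx n hn, hy n hn, add_zero]

/-- Each `s` is disjoint from `x ⊓ |n|` and both lie below `x`, so their sum does too; hence `x - x
⊓ |n|` still bounds `S`. -/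
theorem IsLUB.mem_disjointCompl {N S : Set E} {x : E} (hS : IsLUB S x)
    (h0 : ∀ s ∈ S, 0 ≤ s) (hx : 0 ≤ x) (h : S ⊆ disjointCompl N) : x ∈ disjointCompl N := by
  intro n hn
  rw [abs_of_nonneg hx]
  have hp : 0 ≤ x ⊓ |n| := le_inf hx (abs_nonneg _)
  refine le_antisymm ?_ hp
  have : x ≤ x - x ⊓ |n| := hS.2 fun s hs => by
    rw [le_sub_iff_add_le]
    refine add_le_of_inf_eq_zero ?_ (hS.1 hs) inf_le_left
    have := h hs n hn
    rw [abs_of_nonneg (h0 s hs)] at this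
    exact inf_eq_zero_of_le this (h0 s hs) hp le_rfl inf_le_right
  simpa using this

/-- In an Archimedean vector lattice the differences between the upper bounds of a set and its
elements have infimum `0`. -/
theorem IsArchimedeanLattice.isGLB_upperBounds_sub (hE : IsArchimedeanLattice E) {S : Set E}
    (hS : S.Nonempty) (hb : BddAbove S) :
    IsGLB {d | ∃ u ∈ upperBounds S, ∃ s ∈ S, d = u - s} 0 := by
  refine ⟨?_, ?_⟩
  · rintro _ ⟨u, hu, s, hs, rfl⟩
    exact sub_nonneg.2 (hu hs)
  · intro w hw
    obtain ⟨s, hs⟩ := hS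
    obtain ⟨u, hu⟩ := hb
    have hw' : ∀ u ∈ upperBounds S, ∀ s ∈ S, w ⊔ 0 ≤ u - s := fun u hu s hs =>
      sup_le (hw ⟨u, hu, s, hs, rfl⟩) (sub_nonneg.2 (hu hs))
    have : w ⊔ 0 = 0 := hE.eq_zero_of_sub_mem (T := upperBounds S) le_sup_right hu
      (fun v hv => hv hs) fun v hv s hs => le_sub_comm.1 (hw' v hv s hs)
    exact this ▸ le_sup_left

/-- A sequence of positive elements, bounded above, order converges to `0` if its eventual upper
bounds have no positive lower bound except `0`. -/
theorem orderConverges_zero_of_eventual_upperBounds {z : ℕ → E} (h0 : ∀ n, 0 ≤ z n) {b : E}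
    (hb : ∀ n, z n ≤ b)
    (h : ∀ w, 0 ≤ w → (∀ n, ∀ u, (∀ m, n ≤ m → z m ≤ u) → w ≤ u) → w = 0) :
    OrderConverges z 0 := by
  let D : Set E := {u | ∃ n, ∀ m, n ≤ m → z m ≤ u}
  have hpos : ∀ u ∈ D, 0 ≤ u := by
    rintro u ⟨n, hn⟩
    exact (h0 n).trans (hn n le_rfl)
  refine ⟨(D)ᵒᵈ, inferInstance, ⟨OrderDual.toDual ⟨b, 0, fun m _ => hb m⟩⟩, ⟨?_⟩,
    fun u => (OrderDual.ofDual u).1, fun _ _ huv => huv, ⟨?_, ?_⟩, ?_⟩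
  · rintro ⟨u, n, hn⟩ ⟨v, k, hk⟩
    exact ⟨OrderDual.toDual ⟨u ⊓ v, max n k, fun m hm => le_inf
      (hn m ((le_max_left _ _).trans hm)) (hk m ((le_max_right _ _).trans hm))⟩,
      inf_le_left (a := u) (b := v), inf_le_right (a := u) (b := v)⟩
  · rintro _ ⟨u, rfl⟩
    exact hpos _ (OrderDual.ofDual u).2
  · intro w hw
    have : w ⊔ 0 = 0 := h _ le_sup_right fun n u hu =>
      sup_le (hw ⟨OrderDual.toDual ⟨u, n, hu⟩, rfl⟩) (hpos u ⟨n, hu⟩)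
    exact this ▸ le_sup_left
  · rintro ⟨u, n, hn⟩
    refine ⟨n, fun m hm => ?_⟩
    rw [sub_zero, abs_of_nonneg (h0 m)]
    exact hn m hm

/-- The limit of an increasing uo-convergent sequence is its supremum, provided that it is an upper
bound. -/
theorem UOConverges.le_of_forall_le {y : ℕ → E} {x u : E} (h : UOConverges y x)
    (hm : Monotone y) (hy : ∀ n, y n ≤ x) (hu : ∀ n, y n ≤ u) : x ≤ u := by
  -- Truncation at `x - y 0` has no effect, since `x - y n ≤ x - y 0`.
  obtain ⟨B, _, _, _, z, -, hz, hB⟩ := h (x - y 0)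
  rw [← sub_nonpos]
  refine hz.2 ?_
  rintro _ ⟨β, rfl⟩
  obtain ⟨n, hn⟩ := hB β
  have := hn n le_rfl
  dsimp only at this
  rw [abs_of_nonneg (sub_nonneg.2 (hy 0)), abs_sub_comm (y n), abs_of_nonneg (sub_nonneg.2 (hy n)),
    inf_eq_left.2 (sub_le_sub_left (hm (Nat.zero_le n)) x), sub_zero,
    abs_of_nonneg (sub_nonneg.2 (hy n))] at this
  exact (sub_le_sub_left (hu n) x).trans this

end LatticeGroup

/-! ### Normal sequences and the Lebesgue property -/

section Topology

variable {E : Type u} [AddCommGroup E] [Lattice E] [TopologicalSpace E]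

theorem IsNormalSolidSeq.zero_mem {V : ℕ → Set E} (hV : IsNormalSolidSeq V) (n : ℕ) : 0 ∈ V n :=
  mem_of_mem_nhds (hV.1 n)

theorem IsNormalSolidSeq.antitone {V : ℕ → Set E} (hV : IsNormalSolidSeq V) : Antitone V :=
  antitone_nat_of_succ_le fun n x hx => by
    simpa using hV.2.2 n x hx 0 (hV.zero_mem _)

theorem IsNormalSolidSeq.add_mem {V : ℕ → Set E} (hV : IsNormalSolidSeq V) {x y : E}
    (hx : x ∈ ⋂ n, V n) (hy : y ∈ ⋂ n, V n) : x + y ∈ ⋂ n, V n := by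
  rw [mem_iInter] at *
  exact fun n => hV.2.2 n x (hx _) y (hy _)

/-- The first term and, by induction at level `m + 1`, the remaining sum both lie in `V (m + 1)`. -/
theorem IsNormalSolidSeq.sum_mem {V : ℕ → Set E} (hV : IsNormalSolidSeq V) (k : ℕ) :
    ∀ (m : ℕ) (x : ℕ → E), (∀ j, x j ∈ V (m + 1 + j)) → ∑ j ∈ Finset.range k, x j ∈ V m := by
  induction k with
  | zero => exact fun m x _ => by simpa using hV.zero_mem m
  | succ k ih =>
    intro m x hx
    rw [Finset.sum_range_succ']
    refine hV.2.2 m _ (ih (m + 1) _ fun j => ?_) _ (by simpa using hx 0)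
    have := hx (j + 1)
    rwa [show m + 1 + (j + 1) = m + 1 + 1 + j by ring] at this

/-- Countably many normal sequences have a common refinement. -/
theorem IsNormalSolidSeq.exists_iInter_subset {V : ℕ → ℕ → Set E}
    (hV : ∀ k, IsNormalSolidSeq (V k)) :
    ∃ W : ℕ → Set E, IsNormalSolidSeq W ∧ ∀ k, ⋂ n, W n ⊆ ⋂ n, V k n := by
  -- Only `k ≤ n` enter at stage `n`, so the intersections are finite and remain neighbourhoods.
  refine ⟨fun n => ⋂ k ∈ Finset.range (n + 1), V k n, ⟨fun n => ?_, fun n x hx y hxy => ?_,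
    fun n x hx y hy => ?_⟩, fun k x hx => ?_⟩
  · exact (Filter.biInter_finset_mem _).2 fun k _ => (hV k).1 n
  · rw [mem_iInter₂] at *
    exact fun k hk => (hV k).2.1 n (hx k hk) hxy
  · rw [mem_iInter₂] at *
    intro k hk
    have hk' : k ∈ Finset.range (n + 1 + 1) := by
      rw [Finset.mem_range] at *
      omega
    exact (hV k).2.2 n x (hx k hk') y (hy k hk')
  · rw [mem_iInter] at *
    intro n
    have := mem_iInter₂.1 (hx (max n k)) k (Finset.mem_range.2 (by omega))
    exact (hV k).antitone (le_max_left n k) this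

namespace IsOLebesgue

variable [Module ℝ E]

/-- Every neighbourhood of zero contains the first member of a normal sequence. -/
theorem exists_normalSolidSeq (hτ : IsOLebesgue E) {U : Set E} (hU : U ∈ 𝓝 (0 : E)) :
    ∃ V : ℕ → Set E, IsNormalSolidSeq V ∧ V 0 ⊆ U := by
  have := hτ.topologicalAddGroup
  have step : ∀ W : Set E, W ∈ 𝓝 (0 : E) → ∃ V : Set E, V ∈ 𝓝 (0 : E) ∧
      LatticeOrderedAddCommGroup.IsSolid V ∧ ∀ x ∈ V, ∀ y ∈ V, x + y ∈ W := by
    intro W hW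
    obtain ⟨W', hW', h⟩ := exists_nhds_zero_half hW
    obtain ⟨V, ⟨hV, hs⟩, hVW⟩ := hτ.hasSolidBasis.mem_iff.1 hW'
    exact ⟨V, hV, hs, fun x hx y hy => h x (hVW hx) y (hVW hy)⟩
  obtain ⟨V₀, ⟨hV₀, hs₀⟩, hVU⟩ := hτ.hasSolidBasis.mem_iff.1 hU
  choose! F hF hFs hFa using step
  let P : ℕ → Set E := fun n => F^[n] V₀
  have hP : ∀ n, P (n + 1) = F (P n) := fun n => Function.iterate_succ_apply' F n V₀
  have hn : ∀ n, P n ∈ 𝓝 (0 : E) := by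
    intro n
    induction n with
    | zero => exact hV₀
    | succ n ih => rw [hP]; exact hF _ ih
  refine ⟨P, ⟨hn, fun n => ?_, fun n => ?_⟩, hVU⟩
  · cases n with
    | zero => exact hs₀
    | succ n => rw [hP]; exact hFs _ (hn n)
  · rw [hP]
    exact hFa _ (hn n)

variable [IsOrderedAddMonoid E]

/-- A downward directed set with infimum `0` meets every neighbourhood of zero. -/
theorem exists_mem_of_isGLB (hτ : IsOLebesgue E) {D : Set E} (hD : D.Nonempty)
    (hdir : ∀ a ∈ D, ∀ b ∈ D, ∃ c ∈ D, c ≤ a ∧ c ≤ b) (hinf : IsGLB D 0) {U : Set E}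
    (hU : U ∈ 𝓝 (0 : E)) : ∃ d ∈ D, d ∈ U := by
  have : Nonempty (D)ᵒᵈ := hD.to_subtype
  have : IsDirectedOrder (D)ᵒᵈ := ⟨by
    rintro ⟨a, ha⟩ ⟨b, hb⟩
    obtain ⟨c, hc, hca, hcb⟩ := hdir a ha b hb
    exact ⟨OrderDual.toDual ⟨c, hc⟩, hca, hcb⟩⟩
  have key : OrderConverges (fun d : (D)ᵒᵈ => (OrderDual.ofDual d).1) 0 := by
    refine ⟨(D)ᵒᵈ, inferInstance, inferInstance, inferInstance, fun d => (OrderDual.ofDual d).1,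
      fun _ _ h => h, ?_, fun β => ⟨β, fun α hα => ?_⟩⟩
    · convert hinf
      ext d
      exact ⟨fun ⟨a, ha⟩ => ha ▸ (OrderDual.ofDual a).2, fun hd => ⟨OrderDual.toDual ⟨d, hd⟩, rfl⟩⟩
    · rw [sub_zero, abs_of_nonneg (hinf.1 (OrderDual.ofDual α).2)]
      exact hα
  obtain ⟨d, hd⟩ := ((hτ.tendsto_of_orderConverges _ _ _ key).eventually hU).exists
  exact ⟨_, (OrderDual.ofDual d).2, hd⟩

/-! ### From the countable sup property to a full carrier -/

/-- The carrier is order dense. -/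
theorem exists_mem_topCarrier (hE : IsArchimedeanLattice E) (hτ : IsOLebesgue E) {w : E}
    (hw : 0 ≤ w) (hw0 : w ≠ 0) : ∃ z ∈ topCarrier E, 0 ≤ z ∧ z ≤ w ∧ z ≠ 0 := by
  have := hτ.t2Space
  obtain ⟨V, hV, hVw⟩ := hτ.exists_normalSolidSeq (isOpen_ne.mem_nhds hw0.symm)
  by_contra! hcon
  set T : Set E := {t | t ∈ ⋂ n, V n ∧ 0 ≤ t ∧ t ≤ w} with hT
  -- For `y` in the null set, `T` is stable under adding `|d| ⊓ |y|`, so `d` is disjoint from the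
  -- null set and `hcon` applies.
  have hadd : ∀ d, 0 ≤ d → d ≤ w → (∀ t ∈ T, t + d ≤ w) → d = 0 := by
    intro d hd hdw hTd
    refine hcon d ⟨V, hV, fun y hy => ?_⟩ hd hdw
    have h0 : 0 ≤ |d| ⊓ |y| := le_inf (abs_nonneg _) (abs_nonneg _)
    have hN : |d| ⊓ |y| ∈ ⋂ n, V n := mem_iInter.2 fun n =>
      hV.2.1 n (mem_iInter.1 hy n) (by rw [abs_of_nonneg h0]; exact inf_le_right)
    refine hE.eq_zero_of_add_mem (T := T) (t := 0) (u := w) h0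
      ⟨mem_iInter.2 hV.zero_mem, le_rfl, hw⟩ (fun t ht => ht.2.2) fun t ht =>
      ⟨hV.add_mem ht.1 hN, add_nonneg ht.2.1 h0, le_trans ?_ (hTd t ht)⟩
    gcongr
    rw [abs_of_nonneg hd]
    exact inf_le_left
  have h0T : 0 ∈ T := ⟨mem_iInter.2 hV.zero_mem, le_rfl, hw⟩
  have hinf : IsGLB ((fun t => w - t) '' T) 0 := by
    refine ⟨?_, fun d hd => ?_⟩
    · rintro _ ⟨t, ht, rfl⟩
      exact sub_nonneg.2 ht.2.2
    · have hdt : ∀ t ∈ T, d ⊔ 0 ≤ w - t := fun t ht =>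
        sup_le (hd ⟨t, ht, rfl⟩) (sub_nonneg.2 ht.2.2)
      have : d ⊔ 0 = 0 := hadd _ le_sup_right (by simpa using hdt 0 h0T) fun t ht => by
        have := hdt t ht
        rwa [le_sub_iff_add_le'] at this
      exact this ▸ le_sup_left
  have hdir : ∀ a ∈ (fun t => w - t) '' T, ∀ b ∈ (fun t => w - t) '' T,
      ∃ c ∈ (fun t => w - t) '' T, c ≤ a ∧ c ≤ b := by
    rintro _ ⟨s, hs, rfl⟩ _ ⟨t, ht, rfl⟩
    refine ⟨_, ⟨s ⊔ t, ⟨mem_iInter.2 fun n => ?_, hs.2.1.trans le_sup_left,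
      sup_le hs.2.2 ht.2.2⟩, rfl⟩, sub_le_sub_left le_sup_left w, sub_le_sub_left le_sup_right w⟩
    refine hV.2.1 n (mem_iInter.1 (hV.add_mem hs.1 ht.1) n) ?_
    rw [abs_of_nonneg (hs.2.1.trans le_sup_left), abs_of_nonneg (add_nonneg hs.2.1 ht.2.1)]
    exact sup_le (le_add_of_nonneg_right ht.2.1) (le_add_of_nonneg_left hs.2.1)
  -- With `w - t` and `t` both in `V 1`, `w` falls in `V 0`, which was chosen to miss it.
  obtain ⟨_, ⟨t, ht, rfl⟩, htV⟩ := hτ.exists_mem_of_isGLB (nonempty_of_mem h0T |>.image _) hdir hinf (hV.1 1)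
  have := hV.2.2 0 _ htV t (mem_iInter.1 ht.1 1)
  rw [sub_add_cancel] at this
  exact hVw this rfl

theorem topCarrier_eq_univ (hE : IsArchimedeanLattice E) (hτ : IsOLebesgue E)
    (h : CountableSupProperty E) : topCarrier E = univ := by
  refine eq_univ_of_forall fun x => ?_
  set S : Set E := {s | s ∈ topCarrier E ∧ 0 ≤ s ∧ s ≤ |x|} with hS
  have h0S : 0 ∈ S := by
    obtain ⟨V, hV, -⟩ := hτ.exists_normalSolidSeq (U := univ) univ_mem
    refine ⟨⟨V, hV, fun y _ => ?_⟩, le_rfl, abs_nonneg x⟩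
    rw [abs_zero]
    exact inf_eq_left.2 (abs_nonneg y)
  have hadd : ∀ s ∈ topCarrier E, ∀ t ∈ topCarrier E, s + t ∈ topCarrier E := by
    rintro s ⟨V, hV, hs⟩ t ⟨W, hW, ht⟩
    obtain ⟨Z, hZ, hZV⟩ := IsNormalSolidSeq.exists_iInter_subset
      (V := fun k => if k = 0 then V else W) fun k => by
        split_ifs <;> assumption
    exact ⟨Z, hZ, add_mem_disjointCompl (disjointCompl_anti (by simpa using hZV 0) hs)
      (disjointCompl_anti (by simpa using hZV 1) ht)⟩
  have hlub : IsLUB S |x| := by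
    refine ⟨fun s hs => hs.2.2, fun u hu => ?_⟩
    by_contra hxu
    have hw : 0 ≤ |x| - |x| ⊓ u := sub_nonneg.2 inf_le_left
    have hw0 : |x| - |x| ⊓ u ≠ 0 := fun h0 => hxu (inf_eq_left.1 (sub_eq_zero.1 h0).symm)
    obtain ⟨z, hz, hz0, hzw, hne⟩ := exists_mem_topCarrier hE hτ hw hw0
    -- Elements of `S` lie below `|x| ⊓ u`, which leaves room for `z`: `S` is stable under adding
    -- `z`.
    refine hne (hE.eq_zero_of_add_mem hz0 h0S hu fun s hs =>
      ⟨hadd s hs.1 z hz, add_nonneg hs.2.1 hz0, ?_⟩)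
    calc s + z ≤ |x| ⊓ u + (|x| - |x| ⊓ u) := add_le_add (le_inf hs.2.2 (hu hs)) hzw
      _ = |x| := by abel
  obtain ⟨C, hCS, hC, hCx⟩ := h S _ hlub
  have hmem : ∃ W : ℕ → Set E, IsNormalSolidSeq W ∧ C ⊆ disjointCompl (⋂ n, W n) := by
    rcases C.eq_empty_or_nonempty with rfl | hne
    · obtain ⟨V, hV, -⟩ := hτ.exists_normalSolidSeq (U := univ) univ_mem
      exact ⟨V, hV, empty_subset _⟩
    · obtain ⟨f, rfl⟩ := hC.exists_eq_range hne
      choose V hV hfV using fun n => (hCS ⟨n, rfl⟩ : f n ∈ S).1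
      obtain ⟨W, hW, hWV⟩ := IsNormalSolidSeq.exists_iInter_subset hV
      refine ⟨W, hW, ?_⟩
      rintro _ ⟨n, rfl⟩
      exact disjointCompl_anti (hWV n) (hfV n)
  obtain ⟨W, hW, hCW⟩ := hmem
  exact ⟨W, hW, mem_disjointCompl_of_abs_le
    (hCx.mem_disjointCompl (fun s hs => (hCS hs).2.1) (abs_nonneg x) hCW) (abs_abs x).ge⟩

/-! ### From a full carrier to uo-convergent embedded sequences -/

/-- A sequence of positive elements each of which is small with respect to normal sequences
carrying its predecessors is uo-convergent to `0`. -/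
theorem orderConverges_inf (hE : IsArchimedeanLattice E) (hτ : IsOLebesgue E) {g : ℕ → E}
    (hg : ∀ n, 0 ≤ g n) {V : ℕ → ℕ → Set E} (hV : ∀ k, IsNormalSolidSeq (V k))
    (hgV : ∀ k, g k ∈ disjointCompl (⋂ n, V k n)) (hsmall : ∀ k n, k < n → g n ∈ V k n)
    {b : E} (hb : 0 ≤ b) : OrderConverges (fun n => g n ⊓ b) 0 := by
  refine orderConverges_zero_of_eventual_upperBounds (fun n => le_inf (hg n) hb)
    (fun n => inf_le_right) fun w hw hwu => ?_
  have hwV : ∀ k m, k ≤ m → w ∈ V k m := by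
    intro k m hkm
    -- The tail starts at `m + 2` so that its finite sums lie in `V k (m + 1)`, leaving one halving
    -- for `u - partialSups z j`.
    let z : ℕ → E := fun j => g (m + 1 + 1 + j) ⊓ b
    let S : Set E := range (partialSups z)
    have hub : ∀ u, u ∈ upperBounds S ↔ ∀ j, z j ≤ u := by
      refine fun u => ⟨fun hu j => (le_partialSups z j).trans (hu ⟨j, rfl⟩), ?_⟩
      rintro hu _ ⟨j, rfl⟩
      exact partialSups_le z j u fun i _ => hu i
    have hbS : b ∈ upperBounds S := (hub b).2 fun j => inf_le_right
    have hne : S.Nonempty := range_nonempty _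
    obtain ⟨_, ⟨u, hu, _, ⟨j, rfl⟩, rfl⟩, hd⟩ := hτ.exists_mem_of_isGLB
      (D := {d | ∃ u ∈ upperBounds S, ∃ s ∈ S, d = u - s}) ⟨_, b, hbS, _, ⟨0, rfl⟩, rfl⟩ (by
        rintro _ ⟨u, hu, _, ⟨i, rfl⟩, rfl⟩ _ ⟨v, hv, _, ⟨j, rfl⟩, rfl⟩
        refine ⟨_, ⟨u ⊓ v, fun s hs => le_inf (hu hs) (hv hs), _, ⟨max i j, rfl⟩, rfl⟩, ?_, ?_⟩
        · exact sub_le_sub inf_le_left ((partialSups z).monotone (le_max_left i j))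
        · exact sub_le_sub inf_le_right ((partialSups z).monotone (le_max_right i j)))
      (hE.isGLB_upperBounds_sub hne ⟨b, hbS⟩) ((hV k).1 (m + 1))
    have hd0 : 0 ≤ u - partialSups z j := sub_nonneg.2 (hu ⟨j, rfl⟩)
    have hsum : ∑ i ∈ Finset.range (j + 1), g (m + 1 + 1 + i) ∈ V k (m + 1) :=
      (hV k).sum_mem _ _ _ fun i => hsmall _ _ (by omega)
    have hle : partialSups z j ≤ ∑ i ∈ Finset.range (j + 1), g (m + 1 + 1 + i) :=
      partialSups_le z j _ fun i hi => inf_le_left.trans <|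
        Finset.single_le_sum (f := fun i => g (m + 1 + 1 + i)) (fun i _ => hg _)
          (Finset.mem_range.2 (by omega))
    refine (hV k).2.1 m ((hV k).2.2 m _ hd _ hsum) ?_
    have hwle : w ≤ u - partialSups z j + ∑ i ∈ Finset.range (j + 1), g (m + 1 + 1 + i) := by
      calc w ≤ u := hwu (m + 1 + 1) u fun n hn => by
            obtain ⟨i, rfl⟩ := Nat.exists_eq_add_of_le hn
            exact (hub u).1 hu i
        _ = u - partialSups z j + partialSups z j := by abel
        _ ≤ _ := by gcongr
    rw [abs_of_nonneg hw, abs_of_nonneg (hw.trans hwle)]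
    exact hwle
  have hdisj : ∀ k, g k ⊓ w = 0 := by
    intro k
    have := hgV k w (mem_iInter.2 fun n =>
      (hV k).antitone (le_max_left n k) (hwV k _ (le_max_right n k)))
    rwa [abs_of_nonneg (hg k), abs_of_nonneg hw] at this
  -- By disjointness, subtracting `w` from an upper bound of all `g n ⊓ b` leaves an upper bound.
  refine hE.eq_zero_of_sub_mem (T := {u | ∀ n, g n ⊓ b ≤ u}) (t := b) (l := w) hw
    (fun n => inf_le_right) (fun u hu => hwu 0 u fun n _ => hu n) fun u hu n => ?_
  rw [le_sub_iff_add_le]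
  refine add_le_of_inf_eq_zero ?_ (hu n) (hwu 0 u fun n _ => hu n)
  exact inf_eq_zero_of_le (hdisj n) (le_inf (hg n) hb) hw inf_le_left le_rfl

theorem exists_embedded_uoConverges (hE : IsArchimedeanLattice E) (hτ : IsOLebesgue E)
    (hC : topCarrier E = univ) {A : Type v} [Preorder A] [Nonempty A] [IsDirectedOrder A]
    {x : A → E} {a : E} (hx : Tendsto x atTop (𝓝 a)) :
    ∃ i : ℕ → A, IsEmbeddedIndex i ∧ UOConverges (fun n => x (i n)) a := by
  have := hτ.topologicalAddGroup
  have := hτ.t2Space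
  by_cases htop : ∃ t : A, IsTop t
  · obtain ⟨t, ht⟩ := htop
    refine ⟨fun _ => t, ⟨monotone_const, fun h => (h ⟨t, ht⟩).elim⟩, fun y => ?_⟩
    have hxt : x t = a := by
      by_contra hne
      obtain ⟨s, hs⟩ := eventually_atTop.1 (hx.eventually (isOpen_ne.mem_nhds (Ne.symm hne)))
      exact hs t (ht s) rfl
    refine orderConverges_zero_of_eventual_upperBounds
      (fun n => le_inf (abs_nonneg _) (abs_nonneg _)) (b := 0) (fun n => ?_) fun w hw h =>
      le_antisymm (h 0 0 fun m _ => ?_) hw <;>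
    simp [hxt]
  · have hlt : ∀ c : A, ∀ᶠ d in atTop, c < d := by
      intro c
      obtain ⟨d, hd⟩ := not_forall.1 (not_exists.1 htop c)
      obtain ⟨e, hce, hde⟩ := exists_ge_ge c d
      filter_upwards [eventually_ge_atTop e] with f hf
      exact lt_of_le_not_ge (hce.trans hf) fun hfc => hd (hde.trans (hf.trans hfc))
    let g : A → E := fun α => |x α - a|
    have hg : ∀ α, 0 ≤ g α := fun α => abs_nonneg _
    choose V hV hgV using fun α => (hC ▸ mem_univ _ : g α ∈ topCarrier E)
    have hsmall : ∀ c n, ∀ᶠ d in atTop, g d ∈ V c n := by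
      intro c n
      have h0 : Tendsto (fun d => x d - a) atTop (𝓝 0) := by simpa using hx.sub_const a
      filter_upwards [h0.eventually ((hV c).1 n)] with d hd
      exact (hV c).2.1 n hd (abs_abs _).le
    -- The first coordinate records a level; being strictly increasing, it is at least `n` at stage
    -- `n`.
    obtain ⟨f, -, hf⟩ := exists_seq_of_forall_finset_exists (α := ℕ × A) (fun _ => True)
      (fun p q => p.1 < q.1 ∧ p.2 < q.2 ∧ g q.2 ∈ V p.2 q.1) fun s _ => by
        obtain ⟨n, hn⟩ := (s.image Prod.fst).exists_nat_subset_range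
        have : ∀ᶠ d in atTop, ∀ p ∈ s, p.2 < d ∧ g d ∈ V p.2 n :=
          (Filter.eventually_all_finset s).2 fun p _ => (hlt _).and (hsmall _ _)
        obtain ⟨d, hd⟩ := this.exists
        exact ⟨(n, d), trivial, fun p hp =>
          ⟨Finset.mem_range.1 (hn (Finset.mem_image_of_mem _ hp)), hd p hp⟩⟩
    have hi : StrictMono fun n => (f n).2 := fun m n hmn => (hf m n hmn).2.1
    have hk : StrictMono fun n => (f n).1 := fun m n hmn => (hf m n hmn).1
    exact ⟨fun n => (f n).2, ⟨hi.monotone, fun _ => hi⟩, fun y =>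
      orderConverges_inf hE hτ (fun n => hg (f n).2) (fun k => hV (f k).2) (fun k => hgV (f k).2)
        (fun k n hkn => (hV _).antitone (hk.le_apply (x := n)) (hf k n hkn).2.2) (abs_nonneg y)⟩

/-! ### From increasing nets to the countable sup property -/

/-- The countable sup property follows if increasing convergent nets of positive elements have
uo-convergent embedded sequences. -/
theorem countableSupProperty (hτ : IsOLebesgue E)
    (h : ∀ (A : Type u) [Preorder A] [Nonempty A] [IsDirectedOrder A] (x : A → E) (a : E),
      (∀ α, 0 ≤ x α) → Monotone x → Tendsto x atTop (𝓝 a) →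
        ∃ i : ℕ → A, IsEmbeddedIndex i ∧ UOConverges (fun n => x (i n)) a) :
    CountableSupProperty E := by
  classical
  intro S x hS
  rcases S.eq_empty_or_nonempty with rfl | ⟨s₀, hs₀⟩
  · exact ⟨∅, Subset.rfl, countable_empty, hS⟩
  -- Inserting `s₀` makes the supremum exist even for empty `F`, and subtracting it makes the net
  -- positive.
  let y : Finset S → E := fun F => (insert ⟨s₀, hs₀⟩ F).sup' (Finset.insert_nonempty _ _)
    Subtype.val - s₀
  have hy_mono : Monotone y := fun F G hFG =>
    sub_le_sub_right (Finset.sup'_mono _ (Finset.insert_subset_insert _ hFG) _) _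
  have hy_nonneg : ∀ F, 0 ≤ y F := fun F =>
    sub_nonneg.2 (Finset.le_sup' (Subtype.val : S → E) (Finset.mem_insert_self ⟨s₀, hs₀⟩ F))
  have hy_le : ∀ F, y F ≤ x - s₀ := fun F =>
    sub_le_sub_right (Finset.sup'_le _ _ fun s _ => hS.1 s.2) _
  have hle_y : ∀ F, ∀ s ∈ F, s.1 - s₀ ≤ y F := fun F s hs =>
    sub_le_sub_right (Finset.le_sup' (Subtype.val : S → E) (Finset.mem_insert_of_mem hs)) _
  have hconv : OrderConverges y (x - s₀) := by
    refine ⟨Finset S, inferInstance, inferInstance, inferInstance, fun F => x - s₀ - y F,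
      fun F G hFG => sub_le_sub_left (hy_mono hFG) _, ⟨?_, fun d hd => ?_⟩, fun F =>
      ⟨F, fun G hFG => ?_⟩⟩
    · rintro _ ⟨F, rfl⟩
      exact sub_nonneg.2 (hy_le F)
    · have : x ≤ x - d := hS.2 fun s hs => by
        have h1 : d ≤ x - s₀ - y {⟨s, hs⟩} := hd ⟨_, rfl⟩
        have h2 := hle_y {⟨s, hs⟩} ⟨s, hs⟩ (Finset.mem_singleton_self _)
        have h3 := h1.trans (sub_le_sub_left h2 _)
        rw [sub_sub_sub_cancel_right] at h3
        exact le_sub_comm.1 h3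
      simpa using this
    · rw [abs_sub_comm, abs_of_nonneg (sub_nonneg.2 (hy_le G))]
      exact sub_le_sub_left (hy_mono hFG) _
  obtain ⟨i, hi, huo⟩ := h (Finset S) y (x - s₀) hy_nonneg hy_mono
    (hτ.tendsto_of_orderConverges _ _ _ hconv)
  have hsub : insert s₀ (⋃ n, Subtype.val '' (i n : Set S)) ⊆ S := by
    refine insert_subset hs₀ (iUnion_subset fun n => ?_)
    rintro _ ⟨s, -, rfl⟩
    exact s.2
  refine ⟨_, hsub, ?_, fun s hs => hS.1 (hsub hs), fun u hu => ?_⟩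
  · exact (countable_iUnion fun n => ((i n).countable_toSet.image _)).insert _
  · have := huo.le_of_forall_le (u := u - s₀) (hy_mono.comp hi.1) (fun n => hy_le _) fun n => by
      refine sub_le_sub_right (Finset.sup'_le _ _ fun s hs => ?_) _
      rcases Finset.mem_insert.1 hs with rfl | hs
      · exact hu (mem_insert _ _)
      · exact hu (mem_insert_of_mem _ (mem_iUnion.2 ⟨n, s, hs, rfl⟩))
    simpa using this

end IsOLebesgue

end Topology

theorem mainTheorem4 {E : Type u} [AddCommGroup E] [Lattice E] [IsOrderedAddMonoid E]
    [Module ℝ E] [IsOrderedModule ℝ E] (hE : IsArchimedeanLattice E)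
    [TopologicalSpace E] (hτ : IsOLebesgue E) :
    List.TFAE [
      topCarrier E = Set.univ,
      CountableSupProperty E,
      ∀ (A : Type u) [Preorder A] [Nonempty A] [IsDirectedOrder A] (x : A → E) (a : E),
        Tendsto x atTop (𝓝 a) →
          ∃ i : ℕ → A, IsEmbeddedIndex i ∧ UOConverges (fun n => x (i n)) a,
      ∀ (A : Type u) [Preorder A] [Nonempty A] [IsDirectedOrder A] (x : A → E) (a : E),
        (∀ α, 0 ≤ x α) → Monotone x → Tendsto x atTop (𝓝 a) →
          ∃ i : ℕ → A, IsEmbeddedIndex i ∧ UOConverges (fun n => x (i n)) a] := by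
  tfae_have 1 → 3 := fun h A _ _ _ x a hx => hτ.exists_embedded_uoConverges hE h hx
  tfae_have 3 → 4 := fun h A _ _ _ x a _ _ hx => h A x a hx
  tfae_have 4 → 2 := fun h => hτ.countableSupProperty h
  tfae_have 2 → 1 := fun h => hτ.topCarrier_eq_univ hE h
  tfae_finish
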